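/- Let $\mathcal X$ be a measurable space with a probability distribution $\mu$, let $r:\mathcal X^2\to\{-1,1\}$ be a binary relation, and let $\Phi:\mathcal X^2\to\mathcal H$ be a feature map into a real Hilbert space with $\sup_z\|\Phi(z)\|\le B$. Let $\mathcal H_K$ be the reproducing kernel Hilbert space of the kernel $K(z,z')=\langle\Phi(z),\Phi(z')\rangle$, i.e. the functions $h=\langle w,\Phi(\cdot)\rangle$, $w\in\mathcal H$, with $\|h\|_K=\inf\{\|w\| : h=\langle w,\Phi(\cdot)\rangle\}$. Let $n\ge 2$, $m\ge 1$, and let $X=(x_1,\dots,x_n)$ be drawn i.i.d. from $\mu$. A labeler, whose choice of positions does not depend on the values of $X$, selects $m$ pairs of positions $(i_k,j_k)$, $k=1,\dots,m$, with $i_k\ne j_k$ and each unordered pair $\{i,j\}$ selected at most once, and returns the training set $D$ of the labeled examples $(z_k,r(z_k))$, $z_k=(x_{i_k},x_{j_k})$. Let $\rho=\max_{1\le i\le n}\#\{k: i\in\{i_k,j_k\}\}$ be the maximum instance frequency. Let $\lambda>0$ and let $h_D$ be the output of the SVM, $$h_D=\operatorname*{arg\,min}_{h\in\mathcal H_K}\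 \widehat R^{\mathrm{hinge}}(h)+\lambda\|h\|_K^2,\qquad \widehat R^{\mathrm{hinge}}(h)=\frac1m\sum_{k=1}^m\max\{0,\,1-r(z_k)h(z_k)\},$$ and let $R^{0/1}(h)=\Pr[r(x,x')\neq\operatorname{sgn}h(x,x')]$ for $(x,x')\sim\mu\otimes\mu$ be the 0-1 risk (with $\operatorname{sgn}0=0$, so that $h(x,x')=0$ counts as an error). Theorem. For every such selection of pairs and every $\delta\in(0,1)$, with probability at least $1-\delta$ over the draw of $X$, $$R^{0/1}(h_D)\ \le\ \widehat R^{\mathrm{hinge}}(h_D)+\frac{2\rho B^2}{\lambda m}+\Big(\frac{2B^2}{\lambda}+1\Big)\sqrt{\frac{\rho}{m}\ln\frac1\delta}.$$ The same bound holds with probability at least $1-\delta$ over the joint draw of $X$ and of the selection, if the selection is random and independent of $X$ (with $\rho$ the maximum instance frequency of the drawn selection). -/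

import Mathlib

open MeasureTheory

namespace PairSVM

noncomputable section

/-- The way a labeler chooses `m` distinct pairs among `n` instances: a simple graph on `n` vertices
with `m` enumerated edges, each edge listed once and in one of its two orientations.
The pattern refers to positions only, never to the values of the instances. -/
structure PairPattern (n m : ℕ) where
  /-- the positions `(i, j)` of the two instances in the `k`-th training pair -/
  pair : Fin m → Fin n × Fin n
  /-- no instance is paired with itself -/
  loopless : ∀ k, (pair k).1 ≠ (pair k).2
  /-- no unordered pair is used twice -/
  distinct : Function.Injective (fun k => s((pair k).1, (pair k).2))

/-- Every set of patterns is an event (there are only finitely many patterns). -/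
instance (n m : ℕ) : MeasurableSpace (PairPattern n m) := ⊤

/-- The number of training pairs in which the `i`-th instance occurs. -/
def PairPattern.freq {n m : ℕ} (G : PairPattern n m) (i : Fin n) : ℕ :=
  (Finset.univ.filter (fun k : Fin m => (G.pair k).1 = i ∨ (G.pair k).2 = i)).card

/-- The maximum instance frequency (maximum degree of the graph of training pairs). -/
def PairPattern.maxFreq {n m : ℕ} (G : PairPattern n m) : ℕ :=
  Finset.univ.sup G.freq

/-- A labeled example over `Z`: a point and a label in `{-1, 1}`. -/
abbrev Example (Z : Type*) := Z × ℤˣ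

/-- The training set: the pairs chosen by `G` among the instances `x`, labeled by the relation `r`. -/
def trainingSet {X : Type*} {n m : ℕ} (r : X × X → ℤˣ) (G : PairPattern n m) (x : Fin n → X) :
    Fin m → Example (X × X) :=
  fun k => ((x (G.pair k).1, x (G.pair k).2), r (x (G.pair k).1, x (G.pair k).2))

/-- Hinge loss of the real prediction `t` for the label `y`. -/
def hingeLoss (y : ℤˣ) (t : ℝ) : ℝ := max 0 (1 - ((y : ℤ) : ℝ) * t)

/-- 0-1 loss of the prediction `sgn t` for the label `y`; since `sgn 0 = 0` is neither label,
`t = 0` counts as an error. -/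
def zeroOneLoss (y : ℤˣ) (t : ℝ) : ℝ :=
  if ((y : ℤ) : ℝ) ≠ Real.sign t then 1 else 0

/-- Empirical hinge risk of `h` on the data `D`. -/
def empHingeRisk {Z : Type*} {m : ℕ} (D : Fin m → Example Z) (h : Z → ℝ) : ℝ :=
  (1 / (m : ℝ)) * ∑ k, hingeLoss (D k).2 (h (D k).1)

/-- 0-1 risk of `h`: expected 0-1 loss on a fresh pair of independent instances with law `μ`. -/
def zeroOneRisk {X : Type*} [MeasurableSpace X] (μ : Measure X) (r : X × X → ℤˣ)
    (h : X × X → ℝ) : ℝ :=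
  ∫ z, zeroOneLoss (r z) (h z) ∂(μ.prod μ)

section Kernel

variable {Z H : Type*} [NormedAddCommGroup H] [InnerProductSpace ℝ H]

/-- The reproducing kernel Hilbert space of the kernel `K z z' = ⟪Φ z, Φ z'⟫`, as the set of
functions `z ↦ ⟪w, Φ z⟫` with `w` in the feature space. -/
def rkhs (Φ : Z → H) : Set (Z → ℝ) := {h | ∃ w : H, ∀ z, h z = inner ℝ w (Φ z)}

/-- The norm of the reproducing kernel Hilbert space: the least norm of a representing vector. -/
def rkhsNorm (Φ : Z → H) (h : Z → ℝ) : ℝ :=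
  sInf {a : ℝ | ∃ w : H, (∀ z, h z = inner ℝ w (Φ z)) ∧ a = ‖w‖}

/-- The regularized empirical hinge risk minimized by the support vector machine. -/
def svmObjective {m : ℕ} (Φ : Z → H) (lam : ℝ) (D : Fin m → Example Z) (h : Z → ℝ) : ℝ :=
  empHingeRisk D h + lam * rkhsNorm Φ h ^ 2

/-- `A` is an SVM learning algorithm on training sets of size `m`: on every training set it
returns a minimizer of the regularized empirical hinge risk over the RKHS of `Φ`. -/
def IsSVMAlgorithm {m : ℕ} (Φ : Z → H) (lam : ℝ) (A : (Fin m → Example Z) → (Z → ℝ)) : Prop :=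
  ∀ D, A D ∈ rkhs Φ ∧ IsMinOn (svmObjective Φ lam D) (rkhs Φ) (A D)

end Kernel

/-- The right-hand side of the risk bound, for the pattern `G` and the hypothesis `h` learned
from the data `D`. -/
def svmBound {Z : Type*} {n m : ℕ} (B lam δ : ℝ) (G : PairPattern n m)
    (D : Fin m → Example Z) (h : Z → ℝ) : ℝ :=
  empHingeRisk D h + 2 * (G.maxFreq : ℝ) * B ^ 2 / (lam * m)
    + (2 * B ^ 2 / lam + 1) * Real.sqrt ((G.maxFreq : ℝ) / m * Real.log (1 / δ))

end

end PairSVM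

/-! The 0-1 loss lies below the ramp loss (hinge truncated at 1), which lies below the hinge loss.
It thus suffices to bound the gap between true and empirical ramp risk of the learned hypothesis;
the ramp loss is 1-Lipschitz and takes values in `[0, 1]`.

Stability: the regularized objective grows by at least `lam * ‖v - w‖ ^ 2` away from its minimizer
`w`. Comparing the minimizers for two training sets that differ in `d` examples shows that all
scores differ by at most `d * β`, with `β = B ^ 2 / (lam * m)` (`norm_sub_le_of_minimizers`,
`IsSVMAlgorithm.abs_sub_le`).

Mean of the gap: exchanging both instances of a training pair with a fresh pair preserves the joint
law and alters at most `2ρ` examples, so the expected gap is at most `2ρβ`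
(`integral_rampRisk_sub_le`).

Deviation: the pattern ignores the values, so replacing instance `i` alters at most `freq i`
examples and moves the gap by at most `freq i * (2β + 1/m)`. Since `∑ freq i ^ 2 ≤ ρ ∑ freq i ≤
2ρm`, McDiarmid's inequality gives the square-root term. For a random pattern, average over its law.

Integrating requires the learned score to be jointly measurable in data and test point. This follows
from uniqueness of the minimizing weight vector, as a limit of measurable near-minimizers
(`IsSVMAlgorithm.measurable`). -/

namespace PairSVM

/-! ### Concentration: Hoeffding's lemma and McDiarmid's inequality. -/

open ProbabilityTheory

/-- Hoeffding's lemma for a random variable of oscillation at most `c`. -/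
theorem integral_exp_sub_integral_le {X : Type*} [MeasurableSpace X] (μ : Measure X)
    [IsProbabilityMeasure μ] {f : X → ℝ} (hf : Measurable f) {M : ℝ} (hM : ∀ x, |f x| ≤ M)
    {c : ℝ} (hc0 : 0 ≤ c) (hc : ∀ x y, |f x - f y| ≤ c) (t : ℝ) :
    ∫ x, Real.exp (t * (f x - ∫ y, f y ∂μ)) ∂μ ≤ Real.exp (t ^ 2 * c ^ 2 / 8) := by
  have : Nonempty X := nonempty_of_isProbabilityMeasure μ
  have hbdd : BddBelow (Set.range f) := ⟨-M, by rintro _ ⟨x, rfl⟩; exact (abs_le.1 (hM x)).1⟩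
  have hmem : ∀ x, f x ∈ Set.Icc (⨅ y, f y) ((⨅ y, f y) + c) := fun x =>
    ⟨ciInf_le hbdd x, by
      have : f x - c ≤ ⨅ y, f y := le_ciInf fun y => by linarith [(abs_le.1 (hc x y)).2]
      linarith⟩
  have h := (hasSubgaussianMGF_of_mem_Icc (μ := μ) hf.aemeasurable (ae_of_all _ hmem)).mgf_le t
  refine h.trans (Real.exp_le_exp.2 (le_of_eq ?_))
  have : ((‖(⨅ y, f y) + c - ⨅ y, f y‖₊ : NNReal) : ℝ) = c := by
    simp [abs_of_nonneg hc0]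
  push_cast [this]
  ring

theorem integrable_of_measurable_of_abs_le {Ω : Type*} [MeasurableSpace Ω] {P : Measure Ω}
    [IsFiniteMeasure P] {f : Ω → ℝ} (hf : Measurable f) {M : ℝ} (hM : ∀ x, |f x| ≤ M) :
    Integrable f P :=
  Integrable.of_bound hf.aestronglyMeasurable M (ae_of_all _ hM)

theorem abs_integral_le_of_abs_le {Ω : Type*} [MeasurableSpace Ω] {P : Measure Ω}
    [IsProbabilityMeasure P] {f : Ω → ℝ} {M : ℝ} (hM : ∀ x, |f x| ≤ M) :
    |∫ x, f x ∂P| ≤ M := by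
  simpa using norm_integral_le_of_norm_le_const (μ := P) (f := f) (C := M) (ae_of_all _ hM)

theorem piFinSuccAbove_zero_symm_apply {X : Type*} [MeasurableSpace X] {n : ℕ}
    (p : X × (Fin n → X)) :
    (MeasurableEquiv.piFinSuccAbove (fun _ : Fin (n + 1) => X) 0).symm p = Fin.cons p.1 p.2 :=
  Fin.insertNth_zero' p.1 p.2

theorem integral_pi_succ {X : Type*} [MeasurableSpace X] (μ : Measure X) [IsProbabilityMeasure μ]
    {n : ℕ} (f : (Fin (n + 1) → X) → ℝ) :
    ∫ x, f x ∂(Measure.pi fun _ => μ) =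
      ∫ p : X × (Fin n → X), f (Fin.cons p.1 p.2) ∂(μ.prod (Measure.pi fun _ => μ)) := by
  have h := (measurePreserving_piFinSuccAbove (fun _ : Fin (n + 1) => μ) 0).symm
  rw [← h.integral_comp' (g := f)]
  simp_rw [piFinSuccAbove_zero_symm_apply]

/-- **McDiarmid's inequality**, in exponential form: a function of independent variables with
differences bounded by `c i` has a sub-Gaussian moment generating function. -/
theorem integral_exp_le_of_bounded_differences {X : Type*} [MeasurableSpace X] (μ : Measure X)
    [IsProbabilityMeasure μ] {n : ℕ} (f : (Fin n → X) → ℝ) (hf : Measurable f) (M : ℝ)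
    (hM : ∀ x, |f x| ≤ M) (c : Fin n → ℝ) (hc0 : ∀ i, 0 ≤ c i)
    (hc : ∀ i x y, |f (Function.update x i y) - f x| ≤ c i) (t : ℝ) :
    ∫ x, Real.exp (t * (f x - ∫ y, f y ∂(Measure.pi fun _ => μ))) ∂(Measure.pi fun _ => μ)
      ≤ Real.exp (t ^ 2 * (∑ i, c i ^ 2) / 8) := by
  induction n with
  | zero =>
    have hconst : ∀ x, f x = f default := fun x => by rw [Subsingleton.elim x default]
    simp [hconst]
  | succ n ih =>
    have hcons : Measurable fun p : X × (Fin n → X) => (Fin.cons p.1 p.2 : Fin (n + 1) → X) := by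
      simp_rw [← piFinSuccAbove_zero_symm_apply]
      exact (MeasurableEquiv.piFinSuccAbove (fun _ : Fin (n + 1) => X) 0).symm.measurable
    have hF : Measurable fun p : X × (Fin n → X) => f (Fin.cons p.1 p.2) := hf.comp hcons
    set Q : Measure (Fin n → X) := Measure.pi fun _ => μ
    -- Averaging out the first coordinate keeps the other bounded differences, so the induction
    -- hypothesis applies to `g`; the fluctuation around `g` is left to Hoeffding's lemma in the
    -- first coordinate.
    set g : (Fin n → X) → ℝ := fun y => ∫ a, f (Fin.cons a y) ∂μ with hg
    have hslice : ∀ y, Measurable fun a => f (Fin.cons a y) := fun y =>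
      hF.comp (measurable_id.prodMk measurable_const)
    have hgm : Measurable g :=
      (hF.stronglyMeasurable.integral_prod_left (μ := μ)).measurable
    have hgM : ∀ y, |g y| ≤ M := fun y => abs_integral_le_of_abs_le fun a => hM _
    have hgc : ∀ i x y, |g (Function.update x i y) - g x| ≤ c i.succ := by
      intro i x y
      rw [hg]
      simp only
      rw [← integral_sub (integrable_of_measurable_of_abs_le (hslice _) fun a => hM _)
        (integrable_of_measurable_of_abs_le (hslice _) fun a => hM _)]
      refine abs_integral_le_of_abs_le fun a => ?_
      rw [Fin.cons_update]
      exact hc _ _ _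
    have hint : ∫ x, f x ∂(Measure.pi fun _ => μ) = ∫ y, g y ∂Q := by
      rw [integral_pi_succ, integral_prod_symm]
      exact integrable_of_measurable_of_abs_le hF fun p => hM _
    rw [hint, integral_pi_succ]
    set E := ∫ y, g y ∂Q with hE
    have hEM : |E| ≤ M := abs_integral_le_of_abs_le hgM
    have hbound : ∀ u : ℝ, |u| ≤ M → ∀ v : ℝ, |v| ≤ M →
        |Real.exp (t * (u - v))| ≤ Real.exp (|t| * (M + M)) := by
      intro u hu v hv
      rw [Real.abs_exp, Real.exp_le_exp]
      calc t * (u - v) ≤ |t * (u - v)| := le_abs_self _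
        _ = |t| * |u - v| := abs_mul _ _
        _ ≤ |t| * (M + M) :=
          mul_le_mul_of_nonneg_left ((abs_sub _ _).trans (add_le_add hu hv)) (abs_nonneg _)
    have hexp : Integrable (fun p : X × (Fin n → X) => Real.exp (t * (f (Fin.cons p.1 p.2) - E)))
        (μ.prod Q) :=
      integrable_of_measurable_of_abs_le
        (Real.measurable_exp.comp ((hF.sub_const E).const_mul t)) fun p => hbound _ (hM _) _ hEM
    rw [integral_prod_symm _ hexp]
    have hinner : ∀ y, ∫ a, Real.exp (t * (f (Fin.cons a y) - E)) ∂μ ≤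
        Real.exp (t * (g y - E)) * Real.exp (t ^ 2 * c 0 ^ 2 / 8) := by
      intro y
      have : ∀ a, Real.exp (t * (f (Fin.cons a y) - E)) =
          Real.exp (t * (g y - E)) * Real.exp (t * (f (Fin.cons a y) - g y)) := fun a => by
        rw [← Real.exp_add]; ring_nf
      simp_rw [this]
      rw [integral_const_mul]
      refine mul_le_mul_of_nonneg_left ?_ (Real.exp_pos _).le
      refine integral_exp_sub_integral_le μ (hslice y) (fun a => hM _) (hc0 0) (fun a b => ?_) t
      have := hc 0 (Fin.cons b y) a
      rwa [Fin.update_cons_zero] at this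
    have hI : Integrable (fun y => Real.exp (t * (g y - E))) Q :=
      integrable_of_measurable_of_abs_le
        (Real.measurable_exp.comp ((hgm.sub_const E).const_mul t)) fun y => hbound _ (hgM _) _ hEM
    calc _ ≤ ∫ y, Real.exp (t * (g y - E)) * Real.exp (t ^ 2 * c 0 ^ 2 / 8) ∂Q :=
          integral_mono_of_nonneg
            (ae_of_all _ fun y => integral_nonneg fun a => (Real.exp_pos _).le)
            (hI.mul_const _) (ae_of_all _ hinner)
      _ = (∫ y, Real.exp (t * (g y - E)) ∂Q) * Real.exp (t ^ 2 * c 0 ^ 2 / 8) :=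
          integral_mul_const _ _
      _ ≤ Real.exp (t ^ 2 * (∑ i : Fin n, c i.succ ^ 2) / 8) * Real.exp (t ^ 2 * c 0 ^ 2 / 8) :=
          mul_le_mul_of_nonneg_right
            (ih g hgm hgM (fun i => c i.succ) (fun i => hc0 _) hgc) (Real.exp_pos _).le
      _ = _ := by rw [← Real.exp_add, Fin.sum_univ_succ]; ring_nf

/-- **McDiarmid's inequality**, as a tail bound. -/
theorem measure_le_of_bounded_differences {X : Type*} [MeasurableSpace X] (μ : Measure X)
    [IsProbabilityMeasure μ] {n : ℕ} (f : (Fin n → X) → ℝ) (hf : Measurable f) (M : ℝ)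
    (hM : ∀ x, |f x| ≤ M) (c : Fin n → ℝ) (hc0 : ∀ i, 0 ≤ c i)
    (hc : ∀ i x y, |f (Function.update x i y) - f x| ≤ c i) {V : ℝ} (hV : 0 < V)
    (hcV : ∑ i, c i ^ 2 ≤ V) {ε : ℝ} (hε : 0 ≤ ε) :
    (Measure.pi fun _ => μ) {x | ε ≤ f x - ∫ y, f y ∂(Measure.pi fun _ => μ)}
      ≤ ENNReal.ofReal (Real.exp (-(2 * ε ^ 2 / V))) := by
  -- Variance proxy `V / 4`, because `exp (t ^ 2 * V / 8) = exp ((V / 4) * t ^ 2 / 2)`.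
  have hsub : HasSubgaussianMGF (fun x => f x - ∫ y, f y ∂(Measure.pi fun _ => μ))
      (V / 4).toNNReal (Measure.pi fun _ : Fin n => μ) := by
    have hE : |∫ y, f y ∂(Measure.pi fun _ => μ)| ≤ M := abs_integral_le_of_abs_le hM
    refine ⟨fun t => ?_, fun t => ?_⟩
    · refine integrable_exp_mul_of_mem_Icc (a := -(M + M)) (b := M + M)
        (hf.sub_const _).aemeasurable (ae_of_all _ fun x => abs_le.1 ?_)
      exact (abs_sub _ _).trans (add_le_add (hM x) hE)
    · refine (integral_exp_le_of_bounded_differences μ f hf M hM c hc0 hc t).trans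
        (Real.exp_le_exp.2 ?_)
      rw [Real.coe_toNNReal _ (by positivity)]
      nlinarith [mul_le_mul_of_nonneg_left hcV (sq_nonneg t)]
  have h := hsub.measure_ge_le hε
  rw [← ENNReal.ofReal_toReal (measure_ne_top (Measure.pi fun _ : Fin n => μ) _)]
  refine ENNReal.ofReal_le_ofReal (h.trans (Real.exp_le_exp.2 (le_of_eq ?_)))
  rw [Real.coe_toNNReal _ (by positivity)]
  field_simp
  ring

end PairSVM

/-! ### Losses, strong convexity and stability of the SVM. -/

namespace PairSVM

/-- The hinge loss truncated at `1`. -/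
noncomputable def rampLoss (y : ℤˣ) (t : ℝ) : ℝ := min 1 (hingeLoss y t)

theorem abs_label (y : ℤˣ) : |((y : ℤ) : ℝ)| = 1 := by
  rcases Int.units_eq_one_or y with rfl | rfl <;> simp

theorem abs_hingeLoss_sub_le (y : ℤˣ) (s t : ℝ) : |hingeLoss y s - hingeLoss y t| ≤ |s - t| := by
  refine (abs_max_sub_max_le_max _ _ _ _).trans (le_of_eq ?_)
  rw [sub_self, abs_zero, max_eq_right (abs_nonneg _), sub_sub_sub_cancel_left, ← mul_sub, abs_mul,
    abs_label, one_mul, abs_sub_comm]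

theorem hingeLoss_nonneg (y : ℤˣ) (t : ℝ) : 0 ≤ hingeLoss y t := le_max_left _ _

theorem abs_rampLoss_sub_le (y : ℤˣ) (s t : ℝ) : |rampLoss y s - rampLoss y t| ≤ |s - t| := by
  refine (abs_min_sub_min_le_max _ _ _ _).trans ?_
  rw [sub_self, abs_zero, max_eq_right (abs_nonneg _)]
  exact abs_hingeLoss_sub_le y s t

theorem rampLoss_nonneg (y : ℤˣ) (t : ℝ) : 0 ≤ rampLoss y t :=
  le_min zero_le_one (hingeLoss_nonneg y t)

theorem rampLoss_le_one (y : ℤˣ) (t : ℝ) : rampLoss y t ≤ 1 := min_le_left _ _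

theorem rampLoss_le_hingeLoss (y : ℤˣ) (t : ℝ) : rampLoss y t ≤ hingeLoss y t := min_le_right _ _

theorem zeroOneLoss_nonneg (y : ℤˣ) (t : ℝ) : 0 ≤ zeroOneLoss y t := by
  unfold zeroOneLoss; split_ifs <;> norm_num

/-- An error, including `t = 0`, forces `y * t ≤ 0`, hence hinge loss at least `1`, and truncation
at `1` does no harm. -/
theorem zeroOneLoss_le_rampLoss (y : ℤˣ) (t : ℝ) : zeroOneLoss y t ≤ rampLoss y t := by
  unfold zeroOneLoss
  split_ifs with h
  · refine le_min le_rfl (le_max_of_le_right ?_)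
    have : ((y : ℤ) : ℝ) * t ≤ 0 := by
      rcases Int.units_eq_one_or y with rfl | rfl
      · by_contra! hc
        exact h (by rw [Real.sign_of_pos (by simpa using hc)]; simp)
      · by_contra! hc
        exact h (by rw [Real.sign_of_neg (by simpa using hc)]; simp)
    linarith
  · exact rampLoss_nonneg y t

theorem hingeLoss_convex (y : ℤˣ) {a b : ℝ} (ha : 0 ≤ a) (hb : 0 ≤ b) (hab : a + b = 1) (s t : ℝ) :
    hingeLoss y (a * s + b * t) ≤ a * hingeLoss y s + b * hingeLoss y t := by
  refine max_le
    (add_nonneg (mul_nonneg ha (hingeLoss_nonneg _ _)) (mul_nonneg hb (hingeLoss_nonneg _ _))) ?_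
  have h1 : a * (1 - ((y : ℤ) : ℝ) * s) ≤ a * hingeLoss y s :=
    mul_le_mul_of_nonneg_left (le_max_right _ _) ha
  have h2 : b * (1 - ((y : ℤ) : ℝ) * t) ≤ b * hingeLoss y t :=
    mul_le_mul_of_nonneg_left (le_max_right _ _) hb
  linear_combination h1 + h2 - hab

section Kernel

variable {Z H : Type*} [NormedAddCommGroup H] [InnerProductSpace ℝ H]

/-- The SVM objective as a function of the weight vector. -/
noncomputable def weightObjective {m : ℕ} (Φ : Z → H) (lam : ℝ) (D : Fin m → Example Z) (w : H) :
    ℝ :=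
  empHingeRisk D (fun z => inner ℝ w (Φ z)) + lam * ‖w‖ ^ 2

theorem empHingeRisk_nonneg {m : ℕ} (D : Fin m → Example Z) (h : Z → ℝ) : 0 ≤ empHingeRisk D h :=
  mul_nonneg (by positivity) (Finset.sum_nonneg fun _ _ => hingeLoss_nonneg _ _)

theorem rkhsNorm_le {Φ : Z → H} {h : Z → ℝ} {w : H} (hw : ∀ z, h z = inner ℝ w (Φ z)) :
    rkhsNorm Φ h ≤ ‖w‖ :=
  csInf_le ⟨0, by rintro _ ⟨v, -, rfl⟩; exact norm_nonneg v⟩ ⟨w, hw, rfl⟩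

theorem rkhsNorm_nonneg (Φ : Z → H) (h : Z → ℝ) : 0 ≤ rkhsNorm Φ h :=
  Real.sInf_nonneg (by rintro _ ⟨v, -, rfl⟩; exact norm_nonneg v)

theorem inner_starProjection_of_mem {S : Submodule ℝ H} [S.HasOrthogonalProjection] {v : H}
    (hv : v ∈ S) (w : H) : (inner ℝ (S.starProjection w) v : ℝ) = inner ℝ w v := by
  rw [Submodule.inner_starProjection_left_eq_right,
    Submodule.starProjection_eq_self_iff.2 hv]

/-- In the feature space, an element of the RKHS has a representing vector of least norm. -/
theorem exists_norm_eq_rkhsNorm [CompleteSpace H] {Φ : Z → H} {h : Z → ℝ} (hh : h ∈ rkhs Φ) :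
    ∃ w : H, (∀ z, h z = inner ℝ w (Φ z)) ∧ rkhsNorm Φ h = ‖w‖ := by
  obtain ⟨w, hw⟩ := hh
  -- The least-norm representative is the projection onto the closed span of the features: two
  -- representatives of `h` differ by a vector orthogonal to every `Φ z`, so they share this
  -- projection.
  let S : Submodule ℝ H := (Submodule.span ℝ (Set.range Φ)).topologicalClosure
  have hmem : ∀ z, Φ z ∈ S := fun z =>
    Submodule.le_topologicalClosure _ (Submodule.subset_span ⟨z, rfl⟩)
  have : CompleteSpace S := (Submodule.isClosed_topologicalClosure _).completeSpace_coe
  have hrep : ∀ z, h z = inner ℝ (S.starProjection w) (Φ z) := fun z => by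
    rw [inner_starProjection_of_mem (hmem z), hw]
  refine ⟨S.starProjection w, hrep, le_antisymm (rkhsNorm_le hrep) ?_⟩
  refine le_csInf ⟨_, w, hw, rfl⟩ ?_
  rintro _ ⟨v, hv, rfl⟩
  have hperp : w - v ∈ Sᗮ := by
    rw [Submodule.orthogonal_closure, Submodule.mem_orthogonal']
    intro u hu
    induction hu using Submodule.span_induction with
    | mem x hx =>
      obtain ⟨z, rfl⟩ := hx
      rw [inner_sub_left, ← hw, ← hv, sub_self]
    | zero => exact inner_zero_right _
    | add x y _ _ hx hy => rw [inner_add_right, hx, hy, add_zero]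
    | smul a x _ hx => rw [inner_smul_right, hx, mul_zero]
  have : S.starProjection w = S.starProjection v := by
    rw [← sub_eq_zero, ← map_sub]
    exact (Submodule.starProjection_apply_eq_zero_iff S).2 hperp
  rw [this]
  exact Submodule.norm_starProjection_apply_le _ _

/-- A minimizer over the RKHS is represented by a minimizer over the feature space. -/
theorem exists_weight_of_isMinOn [CompleteSpace H] {m : ℕ} {Φ : Z → H} {lam : ℝ} (hlam : 0 < lam)
    {D : Fin m → Example Z} {h : Z → ℝ} (hh : h ∈ rkhs Φ)
    (hmin : IsMinOn (svmObjective Φ lam D) (rkhs Φ) h) :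
    ∃ w : H, (∀ z, h z = inner ℝ w (Φ z)) ∧
      ∀ v, weightObjective Φ lam D w ≤ weightObjective Φ lam D v := by
  obtain ⟨w, hw, hn⟩ := exists_norm_eq_rkhsNorm hh
  refine ⟨w, hw, fun v => ?_⟩
  have h1 := isMinOn_iff.1 hmin (fun z => inner ℝ v (Φ z)) ⟨v, fun _ => rfl⟩
  have h2 : rkhsNorm Φ (fun z => (inner ℝ v (Φ z) : ℝ)) ^ 2 ≤ ‖v‖ ^ 2 :=
    pow_le_pow_left₀ (rkhsNorm_nonneg _ _) (rkhsNorm_le fun _ => rfl) 2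
  unfold svmObjective at h1
  rw [hn] at h1
  have h3 : (fun z => (inner ℝ w (Φ z) : ℝ)) = h := funext fun z => (hw z).symm
  unfold weightObjective
  rw [h3]
  exact h1.trans (by gcongr)

theorem empHingeRisk_convex {m : ℕ} (D : Fin m → Example Z) {a b : ℝ} (ha : 0 ≤ a) (hb : 0 ≤ b)
    (hab : a + b = 1) (f g : Z → ℝ) :
    empHingeRisk D (fun z => a * f z + b * g z) ≤ a * empHingeRisk D f + b * empHingeRisk D g := by
  unfold empHingeRisk
  have : ∑ k, hingeLoss (D k).2 (a * f (D k).1 + b * g (D k).1) ≤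
      a * ∑ k, hingeLoss (D k).2 (f (D k).1) + b * ∑ k, hingeLoss (D k).2 (g (D k).1) := by
    rw [Finset.mul_sum, Finset.mul_sum, ← Finset.sum_add_distrib]
    exact Finset.sum_le_sum fun k _ => hingeLoss_convex _ ha hb hab _ _
  calc _ ≤ _ := mul_le_mul_of_nonneg_left this (by positivity)
    _ = _ := by ring

/-- Strong convexity of the SVM objective at its minimizer. -/
theorem weightObjective_add_le {m : ℕ} {Φ : Z → H} {lam : ℝ} {D : Fin m → Example Z} {w : H}
    (hw : ∀ v, weightObjective Φ lam D w ≤ weightObjective Φ lam D v) (v : H) :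
    weightObjective Φ lam D w + lam * ‖v - w‖ ^ 2 ≤ weightObjective Φ lam D v := by
  -- Minimality of `w` is tested at a point of the segment towards `v`; dividing by `s` and letting
  -- `s → 0` gives the full constant `lam`.
  have key : ∀ s : ℝ, 0 < s → s < 1 →
      lam * (1 - s) * ‖v - w‖ ^ 2 ≤ weightObjective Φ lam D v - weightObjective Φ lam D w := by
    intro s hs0 hs1
    have h1 := hw ((1 - s) • w + s • v)
    have h2 := empHingeRisk_convex D (sub_nonneg.2 hs1.le) hs0.le (sub_add_cancel 1 s)
      (fun z => (inner ℝ w (Φ z) : ℝ)) (fun z => inner ℝ v (Φ z))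
    have h3 : ‖(1 - s) • w + s • v‖ ^ 2 =
        (1 - s) * ‖w‖ ^ 2 + s * ‖v‖ ^ 2 - s * (1 - s) * ‖v - w‖ ^ 2 := by
      rw [norm_add_sq_real, norm_sub_sq_real, norm_smul, norm_smul, inner_smul_left,
        inner_smul_right, mul_pow, mul_pow, Real.norm_eq_abs, Real.norm_eq_abs, sq_abs, sq_abs,
        real_inner_comm]
      simp only [conj_trivial]
      ring
    unfold weightObjective at h1 ⊢
    simp only [inner_add_left, inner_smul_left, conj_trivial] at h1
    rw [h3] at h1
    have : s * (lam * (1 - s) * ‖v - w‖ ^ 2) ≤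
        s * (empHingeRisk D (fun z => (inner ℝ v (Φ z) : ℝ)) + lam * ‖v‖ ^ 2
          - (empHingeRisk D (fun z => (inner ℝ w (Φ z) : ℝ)) + lam * ‖w‖ ^ 2)) := by
      linear_combination h1 + h2
    exact le_of_mul_le_mul_left this hs0
  have hlim : Filter.Tendsto (fun s : ℝ => lam * (1 - s) * ‖v - w‖ ^ 2)
      (nhdsWithin 0 (Set.Ioi 0)) (nhds (lam * (1 - 0) * ‖v - w‖ ^ 2)) :=
    (Continuous.tendsto (by fun_prop) 0).mono_left nhdsWithin_le_nhds
  have := le_of_tendsto hlim (Filter.eventually_of_mem (Ioo_mem_nhdsGT one_pos)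
    fun s hs => key s hs.1 hs.2)
  linarith

/-- Stability: the weight vector of an SVM moves by at most `d B / (lam m)` when `d` of the `m`
training examples are changed. -/
theorem norm_sub_le_of_minimizers {m : ℕ} (hm : 1 ≤ m) {Φ : Z → H} {B : ℝ} (hB : ∀ z, ‖Φ z‖ ≤ B)
    {lam : ℝ} (hlam : 0 < lam) {D D' : Fin m → Example Z} (S : Finset (Fin m))
    (hS : ∀ k ∉ S, D k = D' k) {w w' : H}
    (hw : ∀ v, weightObjective Φ lam D w ≤ weightObjective Φ lam D v)
    (hw' : ∀ v, weightObjective Φ lam D' w' ≤ weightObjective Φ lam D' v) :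
    ‖w - w'‖ ≤ S.card * B / (lam * m) := by
  have hm0 : (0 : ℝ) < m := by exact_mod_cast hm
  have h1 := weightObjective_add_le hw w'
  have h2 := weightObjective_add_le hw' w
  have hlip : ∀ E : Example Z, |hingeLoss E.2 (inner ℝ w' (Φ E.1)) -
      hingeLoss E.2 (inner ℝ w (Φ E.1))| ≤ B * ‖w - w'‖ := by
    intro E
    refine (abs_hingeLoss_sub_le _ _ _).trans ?_
    rw [← inner_sub_left, norm_sub_rev w w', mul_comm]
    exact (abs_real_inner_le_norm _ _).trans
      (mul_le_mul_of_nonneg_left (hB _) (norm_nonneg _))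
  -- Adding the two strong convexity inequalities cancels the norms of `w` and `w'`, leaving these
  -- loss differences, which vanish outside `S`.
  have h3 : ∑ k, ((hingeLoss (D k).2 (inner ℝ w' (Φ (D k).1)) -
      hingeLoss (D k).2 (inner ℝ w (Φ (D k).1))) - (hingeLoss (D' k).2 (inner ℝ w' (Φ (D' k).1)) -
      hingeLoss (D' k).2 (inner ℝ w (Φ (D' k).1)))) ≤ S.card * (2 * (B * ‖w - w'‖)) := by
    rw [← Finset.sum_subset (Finset.subset_univ S) (fun k _ hk => by rw [hS k hk, sub_self]),
      ← nsmul_eq_mul]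
    refine Finset.sum_le_card_nsmul _ _ _ fun k _ => ?_
    linarith [(abs_le.1 (hlip (D k))).2, (abs_le.1 (hlip (D' k))).1]
  simp only [Finset.sum_sub_distrib] at h3
  have h4 := mul_le_mul_of_nonneg_left h3 (one_div_nonneg.2 hm0.le)
  unfold weightObjective empHingeRisk at h1 h2
  rw [norm_sub_rev w' w] at h1
  have h5 : ‖w - w'‖ * (lam * m * ‖w - w'‖) ≤ ‖w - w'‖ * (S.card * B) := by
    have : 2 * lam * ‖w - w'‖ ^ 2 ≤ 1 / m * (S.card * (2 * (B * ‖w - w'‖))) := by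
      linear_combination h1 + h2 + h4
    rw [one_div, ← div_eq_inv_mul, le_div_iff₀ hm0] at this
    linear_combination this / 2
  rw [le_div_iff₀ (mul_pos hlam hm0)]
  rcases (norm_nonneg (w - w')).eq_or_lt with h0 | h0
  -- If `w = w'`, only `0 ≤ B` is needed; it follows from the bound at any point, and `1 ≤ m`
  -- supplies one.
  · obtain hn | ⟨⟨z, -⟩⟩ : IsEmpty (Example Z) ∨ Nonempty (Example Z) := isEmpty_or_nonempty _
    · exact (hn.false (D ⟨0, hm⟩)).elim
    · rw [← h0, zero_mul]
      exact mul_nonneg (Nat.cast_nonneg _) ((norm_nonneg _).trans (hB z))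
  · linarith [le_of_mul_le_mul_left h5 h0]

/-- Stability of the scores of an SVM. -/
theorem IsSVMAlgorithm.abs_sub_le [CompleteSpace H] {m : ℕ} (hm : 1 ≤ m) {Φ : Z → H} {B : ℝ}
    (hB : ∀ z, ‖Φ z‖ ≤ B) {lam : ℝ} (hlam : 0 < lam) {A : (Fin m → Example Z) → Z → ℝ}
    (hA : IsSVMAlgorithm Φ lam A) {D D' : Fin m → Example Z} (S : Finset (Fin m))
    (hS : ∀ k ∉ S, D k = D' k) (z : Z) :
    |A D z - A D' z| ≤ S.card * (B ^ 2 / (lam * m)) := by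
  obtain ⟨w, hw, hmin⟩ := exists_weight_of_isMinOn hlam (hA D).1 (hA D).2
  obtain ⟨w', hw', hmin'⟩ := exists_weight_of_isMinOn hlam (hA D').1 (hA D').2
  have hB0 : 0 ≤ B := (norm_nonneg _).trans (hB z)
  rw [hw, hw', ← inner_sub_left]
  calc _ ≤ ‖w - w'‖ * ‖Φ z‖ := abs_real_inner_le_norm _ _
    _ ≤ S.card * B / (lam * m) * B :=
        mul_le_mul (norm_sub_le_of_minimizers hm hB hlam S hS hmin hmin') (hB z) (norm_nonneg _)
          (by positivity)
    _ = _ := by ring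

end Kernel

end PairSVM

/-! ### Measurability of the learned score. -/

namespace PairSVM

theorem measurable_label : Measurable fun y : ℤˣ => ((y : ℤ) : ℝ) :=
  (measurable_of_countable (fun a : ℤ => (a : ℝ))).comp (comap_measurable Units.val)

theorem measurable_hingeLoss : Measurable fun p : ℤˣ × ℝ => hingeLoss p.1 p.2 := by
  unfold hingeLoss
  exact measurable_const.max
    (measurable_const.sub ((measurable_label.comp measurable_fst).mul measurable_snd))

theorem measurable_rampLoss : Measurable fun p : ℤˣ × ℝ => rampLoss p.1 p.2 :=
  measurable_const.min measurable_hingeLoss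

section Kernel

variable {Z H : Type*} [NormedAddCommGroup H] [InnerProductSpace ℝ H]

/-- The weight vector with coefficients `a` in the training points. -/
def expansion {m : ℕ} (Φ : Z → H) (D : Fin m → Example Z) (a : Fin m → ℝ) : H :=
  ∑ k, a k • Φ (D k).1

theorem inner_expansion {m : ℕ} (Φ : Z → H) (D : Fin m → Example Z) (a : Fin m → ℝ) (z : Z) :
    (inner ℝ (expansion Φ D a) (Φ z) : ℝ) = ∑ k, a k * inner ℝ (Φ (D k).1) (Φ z) := by
  simp [expansion, sum_inner, inner_smul_left]

theorem norm_expansion_sq {m : ℕ} (Φ : Z → H) (D : Fin m → Example Z) (a : Fin m → ℝ) :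
    ‖expansion Φ D a‖ ^ 2 = ∑ l, a l * ∑ k, a k * inner ℝ (Φ (D k).1) (Φ (D l).1) := by
  rw [← real_inner_self_eq_norm_sq]
  conv_lhs => enter [3]; unfold expansion
  simp only [inner_sum, inner_smul_right, inner_expansion]

/-- Representer theorem. -/
theorem exists_eq_expansion {m : ℕ} {Φ : Z → H} {lam : ℝ} (hlam : 0 < lam)
    {D : Fin m → Example Z} {w : H}
    (hw : ∀ v, weightObjective Φ lam D w ≤ weightObjective Φ lam D v) :
    ∃ a : Fin m → ℝ, w = expansion Φ D a := by
  let S : Submodule ℝ H := Submodule.span ℝ (Set.range fun k => Φ (D k).1)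
  have : FiniteDimensional ℝ S := FiniteDimensional.span_of_finite ℝ (Set.finite_range _)
  -- Projecting onto the span of the training features keeps all training scores and does not
  -- increase the norm, so strong convexity forces `w` to equal its projection.
  have h1 := weightObjective_add_le hw (S.starProjection w)
  have h2 : weightObjective Φ lam D (S.starProjection w) ≤ weightObjective Φ lam D w := by
    unfold weightObjective empHingeRisk
    have : ∀ k, (inner ℝ (S.starProjection w) (Φ (D k).1) : ℝ) = inner ℝ w (Φ (D k).1) :=
      fun k => inner_starProjection_of_mem (Submodule.subset_span (Set.mem_range_self k)) w
    simp only [this]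
    have h3 := S.norm_starProjection_apply_le w
    gcongr
  have h4 : ‖S.starProjection w - w‖ ^ 2 ≤ 0 := by
    by_contra! hc
    linarith [mul_pos hlam hc]
  have h5 : S.starProjection w = w := by
    rw [← sub_eq_zero, ← norm_eq_zero]
    exact pow_eq_zero_iff two_ne_zero |>.1 (le_antisymm h4 (sq_nonneg _))
  have h6 : w ∈ S := Submodule.starProjection_eq_self_iff.1 h5
  obtain ⟨a, ha⟩ := (Submodule.mem_span_range_iff_exists_fun ℝ).1 h6
  exact ⟨a, ha.symm⟩

theorem continuous_weightObjective {m : ℕ} (Φ : Z → H) (lam : ℝ) (D : Fin m → Example Z) :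
    Continuous (weightObjective Φ lam D) := by
  unfold weightObjective empHingeRisk hingeLoss
  fun_prop

/-- Rational coefficients are dense and the objective is continuous in them; this reduces the
minimization to a countable family. -/
theorem exists_rat_expansion_lt {m : ℕ} {Φ : Z → H} {lam : ℝ} (hlam : 0 < lam)
    {D : Fin m → Example Z} {w : H}
    (hw : ∀ v, weightObjective Φ lam D w ≤ weightObjective Φ lam D v) {ε : ℝ} (hε : 0 < ε) :
    ∃ a : Fin m → ℚ, weightObjective Φ lam D (expansion Φ D fun k => (a k : ℝ)) <
      weightObjective Φ lam D w + ε := by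
  obtain ⟨a, rfl⟩ := exists_eq_expansion hlam hw
  have hc : Continuous fun b : Fin m → ℝ => weightObjective Φ lam D (expansion Φ D b) :=
    (continuous_weightObjective Φ lam D).comp (by unfold expansion; fun_prop)
  have hd : DenseRange fun (q : Fin m → ℚ) (k : Fin m) => (q k : ℝ) :=
    DenseRange.piMap fun _ => Rat.denseRange_cast
  obtain ⟨q, hq⟩ := hd.exists_mem_open (isOpen_lt hc continuous_const)
    ⟨a, lt_add_of_pos_right (weightObjective Φ lam D (expansion Φ D a)) hε⟩
  exact ⟨q, hq⟩

theorem weightObjective_nonneg {m : ℕ} (Φ : Z → H) {lam : ℝ} (hlam : 0 < lam)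
    (D : Fin m → Example Z) (w : H) : 0 ≤ weightObjective Φ lam D w :=
  add_nonneg (empHingeRisk_nonneg _ _) (by positivity)

/-- The score of an SVM depends measurably on the training set and the test point. -/
theorem IsSVMAlgorithm.measurable [CompleteSpace H] [MeasurableSpace Z] {m : ℕ} {Φ : Z → H}
    (hK : Measurable fun p : Z × Z => (inner ℝ (Φ p.1) (Φ p.2) : ℝ)) {B : ℝ}
    (hB : ∀ z, ‖Φ z‖ ≤ B) {lam : ℝ} (hlam : 0 < lam) {A : (Fin m → Example Z) → Z → ℝ}
    (hA : IsSVMAlgorithm Φ lam A) :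
    Measurable fun p : (Fin m → Example Z) × Z => A p.1 p.2 := by
  choose w hw hmin using fun D => exists_weight_of_isMinOn hlam (hA D).1 (hA D).2
  have hpt : ∀ k : Fin m, Measurable fun D : Fin m → Example Z => (D k).1 := fun k =>
    measurable_fst.comp (measurable_pi_apply k)
  have hlab : ∀ k : Fin m, Measurable fun D : Fin m → Example Z => (D k).2 := fun k =>
    measurable_snd.comp (measurable_pi_apply k)
  have hscore : ∀ a : Fin m → ℝ, Measurable fun p : (Fin m → Example Z) × Z =>
      -- Scores and norms of expansions are polynomials in kernel values, so measurability of the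
      -- kernel suffices.
      (inner ℝ (expansion Φ p.1 a) (Φ p.2) : ℝ) := fun a => by
    simp only [inner_expansion]
    exact Finset.measurable_sum _ fun k _ => measurable_const.mul
      (hK.comp (((hpt k).comp measurable_fst).prodMk measurable_snd))
  have hobj : ∀ a : Fin m → ℝ,
      Measurable fun D : Fin m → Example Z => weightObjective Φ lam D (expansion Φ D a) :=
    fun a => by
      unfold weightObjective empHingeRisk
      simp only [norm_expansion_sq]
      refine (measurable_const.mul (Finset.measurable_sum _ fun k _ => ?_)).add
        (measurable_const.mul (Finset.measurable_sum _ fun l _ => measurable_const.mul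
          (Finset.measurable_sum _ fun k _ => measurable_const.mul
            (hK.comp ((hpt k).prodMk (hpt l))))))
      exact measurable_hingeLoss.comp
        ((hlab k).prodMk ((hscore a).comp (measurable_id.prodMk (hpt k))))
  have hval : ∀ D, (⨅ a : Fin m → ℚ, weightObjective Φ lam D (expansion Φ D fun k => (a k : ℝ)))
      = weightObjective Φ lam D (w D) := fun D => by
    refine le_antisymm (le_of_forall_pos_lt_add fun ε hε => ?_) (le_ciInf fun a => hmin D _)
    obtain ⟨a, ha⟩ := exists_rat_expansion_lt hlam (hmin D) hε
    exact (ciInf_le ⟨0, by rintro _ ⟨b, rfl⟩; exact weightObjective_nonneg Φ hlam D _⟩ a).trans_lt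
      ha
  have hvalm : Measurable fun D => weightObjective Φ lam D (w D) := by
    simp only [← hval]
    exact Measurable.iInf fun a => hobj _
  -- The first rational expansion in an enumeration that is `1 / (N + 1)`-optimal is a measurable
  -- choice; strong convexity makes its score converge to that of the SVM as `N → ∞`.
  obtain ⟨e, he⟩ := exists_surjective_nat (Fin m → ℚ)
  have hex : ∀ (N : ℕ) (p : (Fin m → Example Z) × Z), ∃ j,
      weightObjective Φ lam p.1 (expansion Φ p.1 fun k => (e j k : ℝ)) <
        weightObjective Φ lam p.1 (w p.1) + 1 / ((N : ℝ) + 1) := fun N p => by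
    obtain ⟨a, ha⟩ := exists_rat_expansion_lt hlam (hmin p.1) (Nat.one_div_pos_of_nat (n := N))
    obtain ⟨j, rfl⟩ := he a
    exact ⟨j, ha⟩
  classical
  refine measurable_of_tendsto_metrizable (f := fun N (p : (Fin m → Example Z) × Z) =>
    (inner ℝ (expansion Φ p.1 fun k => (e (Nat.find (hex N p)) k : ℝ)) (Φ p.2) : ℝ))
    (fun N => Measurable.find
      (f := fun j (p : (Fin m → Example Z) × Z) =>
        (inner ℝ (expansion Φ p.1 fun k => (e j k : ℝ)) (Φ p.2) : ℝ))
      (fun j => hscore _)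
      (fun j => measurableSet_lt ((hobj _).comp measurable_fst)
        ((hvalm.comp measurable_fst).add_const _)) (hex N)) ?_
  rw [tendsto_pi_nhds]
  rintro ⟨D, z⟩
  rw [hw, tendsto_iff_dist_tendsto_zero]
  have hlim : Filter.Tendsto (fun N : ℕ => Real.sqrt (1 / ((N : ℝ) + 1) / lam) * B)
      Filter.atTop (nhds 0) := by
    have h0 := (tendsto_one_div_add_atTop_nhds_zero_nat (𝕜 := ℝ)).div_const lam
    have h1 := ((Real.continuous_sqrt.tendsto _).comp h0).mul_const B
    simpa using h1
  refine squeeze_zero (fun _ => dist_nonneg) (fun N => ?_) hlim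
  have hfind := Nat.find_spec (hex N (D, z))
  have hstrong := weightObjective_add_le (hmin D)
    (expansion Φ D fun k => (e (Nat.find (hex N (D, z))) k : ℝ))
  rw [Real.dist_eq, ← inner_sub_left]
  refine (abs_real_inner_le_norm _ _).trans
    (mul_le_mul (Real.le_sqrt_of_sq_le ?_) (hB z) (norm_nonneg _) (Real.sqrt_nonneg _))
  rw [le_div_iff₀ hlam]
  linarith

end Kernel

end PairSVM

/-! ### Exchanging instances of an i.i.d. sample. -/

namespace PairSVM

section Resampling

variable {X : Type*} [MeasurableSpace X] (μ : Measure X) [IsProbabilityMeasure μ]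

/-- Exchanging a coordinate of an i.i.d. sample with a fresh instance preserves the joint law. -/
theorem measurePreserving_update {n : ℕ} (i : Fin n) :
    MeasurePreserving (fun p : (Fin n → X) × X => (Function.update p.1 i p.2, p.1 i))
      ((Measure.pi fun _ => μ).prod μ) ((Measure.pi fun _ => μ).prod μ) := by
  obtain ⟨n, rfl⟩ := Nat.exists_eq_succ_of_ne_zero (Fin.pos i).ne'
  let Q : Measure (Fin n → X) := Measure.pi fun _ => μ
  have he := measurePreserving_piFinSuccAbove (fun _ : Fin (n + 1) => μ) i
  have hid : MeasurePreserving (id : X → X) μ μ := MeasurePreserving.id μ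
  have h1 := he.prod hid
  have h2 : MeasurePreserving Prod.swap ((μ.prod Q).prod μ) (μ.prod (μ.prod Q)) :=
    Measure.measurePreserving_swap
  have h3 : MeasurePreserving (Prod.map id Prod.swap) (μ.prod (μ.prod Q)) (μ.prod (Q.prod μ)) :=
    hid.prod Measure.measurePreserving_swap
  have h4 : MeasurePreserving MeasurableEquiv.prodAssoc.symm (μ.prod (Q.prod μ))
      ((μ.prod Q).prod μ) := (measurePreserving_prodAssoc μ Q μ).symm
  have h5 := (he.symm).prod hid
  -- Split off coordinate `i`, swap it with the fresh instance, and reinsert.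
  convert h5.comp (h4.comp (h3.comp (h2.comp h1))) using 1
  funext p
  refine Prod.ext ?_ rfl
  exact (Fin.insertNth_removeNth i p.2 p.1).symm

/-- Exchanging two coordinates of an i.i.d. sample with a fresh pair preserves the joint law. -/
theorem measurePreserving_update_pair {n : ℕ} {i j : Fin n} (hij : i ≠ j) :
    MeasurePreserving (fun p : (Fin n → X) × (X × X) =>
        (Function.update (Function.update p.1 i p.2.1) j p.2.2, (p.1 i, p.1 j)))
      ((Measure.pi fun _ => μ).prod (μ.prod μ)) ((Measure.pi fun _ => μ).prod (μ.prod μ)) := by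
  let P : Measure (Fin n → X) := Measure.pi fun _ => μ
  have hid : MeasurePreserving (id : X → X) μ μ := MeasurePreserving.id μ
  have h1 : MeasurePreserving MeasurableEquiv.prodAssoc.symm (P.prod (μ.prod μ))
      ((P.prod μ).prod μ) := (measurePreserving_prodAssoc P μ μ).symm
  have h2 := (measurePreserving_update μ i).prod hid
  have h3 : MeasurePreserving MeasurableEquiv.prodAssoc ((P.prod μ).prod μ)
      (P.prod (μ.prod μ)) := measurePreserving_prodAssoc P μ μ
  have h4 : MeasurePreserving (Prod.map id Prod.swap) (P.prod (μ.prod μ)) (P.prod (μ.prod μ)) :=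
    (MeasurePreserving.id P).prod Measure.measurePreserving_swap
  have h5 := (measurePreserving_update μ j).prod hid
  -- Two single exchanges, at `i` and then at `j`; as `i ≠ j`, the second one still releases the
  -- original `x j`.
  convert h4.comp (h3.comp (h5.comp (h1.comp (h4.comp (h3.comp (h2.comp h1)))))) using 1
  funext p
  refine Prod.ext rfl (Prod.ext rfl ?_)
  exact (Function.update_of_ne hij.symm _ _).symm

end Resampling

/-! ### Degree counts for the graph of training pairs. -/

section Pattern

variable {X : Type*} {n m : ℕ}

/-- The training pairs in which the `i`-th instance occurs. -/
def PairPattern.incident (G : PairPattern n m) (i : Fin n) : Finset (Fin m) :=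
  Finset.univ.filter fun k => (G.pair k).1 = i ∨ (G.pair k).2 = i

theorem PairPattern.freq_le_maxFreq (G : PairPattern n m) (i : Fin n) : G.freq i ≤ G.maxFreq :=
  Finset.le_sup (f := G.freq) (Finset.mem_univ i)

/-- Handshake count: each pair has two endpoints. -/
theorem PairPattern.sum_freq_le (G : PairPattern n m) : ∑ i, G.freq i ≤ 2 * m := by
  have h : ∀ i, G.freq i ≤ ∑ k : Fin m,
      ((if (G.pair k).1 = i then 1 else 0) + if (G.pair k).2 = i then 1 else 0) := fun i => by
    unfold freq
    rw [Finset.card_filter]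
    refine Finset.sum_le_sum fun k _ => ?_
    split_ifs <;> simp_all
  refine (Finset.sum_le_sum fun i _ => h i).trans (le_of_eq ?_)
  rw [Finset.sum_comm]
  simp [Finset.sum_add_distrib]
  ring

theorem trainingSet_update_of_notMem (r : X × X → ℤˣ) (G : PairPattern n m) (x : Fin n → X)
    (i : Fin n) (y : X) {k : Fin m} (hk : k ∉ G.incident i) :
    trainingSet r G (Function.update x i y) k = trainingSet r G x k := by
  simp only [PairPattern.incident, Finset.mem_filter, Finset.mem_univ, true_and, not_or] at hk
  simp only [trainingSet, Function.update_of_ne hk.1, Function.update_of_ne hk.2]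

theorem measurable_trainingSet [MeasurableSpace X] {r : X × X → ℤˣ} (hr : Measurable r)
    (G : PairPattern n m) : Measurable (trainingSet r G) := by
  refine measurable_pi_lambda _ fun k => ?_
  have h : Measurable fun x : Fin n → X => (x (G.pair k).1, x (G.pair k).2) :=
    (measurable_pi_apply _).prodMk (measurable_pi_apply _)
  exact h.prodMk (hr.comp h)

instance : Finite (PairPattern n m) :=
  Finite.of_injective PairPattern.pair fun G G' h => by
    cases G; cases G'; cases h; rfl

end Pattern

/-! ### The generalization gap for the ramp loss. -/

section Gap

/-- Empirical ramp risk of `h` on the data `D`. -/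
noncomputable def empRampRisk {Z : Type*} {m : ℕ} (D : Fin m → Example Z) (h : Z → ℝ) : ℝ :=
  (1 / (m : ℝ)) * ∑ k, rampLoss (D k).2 (h (D k).1)

/-- Ramp risk of `h` on a fresh pair of independent instances. -/
noncomputable def rampRisk {X : Type*} [MeasurableSpace X] (μ : Measure X) (r : X × X → ℤˣ)
    (h : X × X → ℝ) : ℝ :=
  ∫ z, rampLoss (r z) (h z) ∂(μ.prod μ)

theorem abs_rampLoss_le_one (y : ℤˣ) (t : ℝ) : |rampLoss y t| ≤ 1 :=
  abs_le.2 ⟨by linarith [rampLoss_nonneg y t], rampLoss_le_one y t⟩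

theorem empRampRisk_le_empHingeRisk {Z : Type*} {m : ℕ} (D : Fin m → Example Z) (h : Z → ℝ) :
    empRampRisk D h ≤ empHingeRisk D h :=
  mul_le_mul_of_nonneg_left (Finset.sum_le_sum fun _ _ => rampLoss_le_hingeLoss _ _)
    (by positivity)

theorem abs_empRampRisk_le_one {Z : Type*} {m : ℕ} (hm : 1 ≤ m) (D : Fin m → Example Z)
    (h : Z → ℝ) : |empRampRisk D h| ≤ 1 := by
  have hm0 : (0 : ℝ) < m := by exact_mod_cast hm
  unfold empRampRisk
  rw [abs_mul, abs_of_nonneg (by positivity), one_div, ← div_eq_inv_mul, div_le_one hm0]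
  refine (Finset.abs_sum_le_sum_abs _ _).trans ?_
  refine (Finset.sum_le_card_nsmul _ _ 1 fun k _ => abs_rampLoss_le_one _ _).trans ?_
  simp

/-- The empirical ramp risk under a change of both the data and the hypothesis. -/
theorem abs_empRampRisk_sub_le {Z : Type*} {m : ℕ} (hm : 1 ≤ m) {D D' : Fin m → Example Z}
    {h h' : Z → ℝ} (S : Finset (Fin m)) (hS : ∀ k ∉ S, D k = D' k) {β : ℝ}
    (hβ : ∀ z, |h z - h' z| ≤ β) :
    |empRampRisk D h - empRampRisk D' h'| ≤ β + S.card / m := by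
  have hm0 : (0 : ℝ) < m := by exact_mod_cast hm
  have hβ0 : 0 ≤ β := (abs_nonneg _).trans (hβ (D ⟨0, hm⟩).1)
  have hterm : ∀ k, |rampLoss (D k).2 (h (D k).1) - rampLoss (D' k).2 (h' (D' k).1)| ≤
      β + if k ∈ S then 1 else 0 := by
    intro k
    split_ifs with hk
    · refine le_add_of_nonneg_of_le hβ0 (abs_le.2 ⟨?_, ?_⟩) <;>
        linarith [rampLoss_nonneg (D k).2 (h (D k).1), rampLoss_le_one (D k).2 (h (D k).1),
          rampLoss_nonneg (D' k).2 (h' (D' k).1), rampLoss_le_one (D' k).2 (h' (D' k).1)]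
    · rw [hS k hk, add_zero]
      exact (abs_rampLoss_sub_le _ _ _).trans (hβ _)
  unfold empRampRisk
  rw [← mul_sub, ← Finset.sum_sub_distrib, abs_mul, abs_of_nonneg (by positivity)]
  calc _ ≤ 1 / (m : ℝ) * ∑ k, (β + if k ∈ S then 1 else 0) :=
        mul_le_mul_of_nonneg_left ((Finset.abs_sum_le_sum_abs _ _).trans
          (Finset.sum_le_sum fun k _ => hterm k)) (by positivity)
    _ = _ := by
        rw [Finset.sum_add_distrib, Finset.sum_ite_mem, Finset.univ_inter]
        simp
        field_simp

variable {X : Type*} [MeasurableSpace X] {μ : Measure X} [IsProbabilityMeasure μ]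
  {r : X × X → ℤˣ}

theorem measurable_rampLoss_comp {Ω : Type*} [MeasurableSpace Ω] {y : Ω → ℤˣ} {h : Ω → ℝ}
    (hy : Measurable y) (hh : Measurable h) : Measurable fun ω => rampLoss (y ω) (h ω) :=
  measurable_rampLoss.comp (hy.prodMk hh)

theorem zeroOneRisk_le_rampRisk (hr : Measurable r) {h : X × X → ℝ} (hh : Measurable h) :
    zeroOneRisk μ r h ≤ rampRisk μ r h :=
  integral_mono_of_nonneg (ae_of_all _ fun _ => zeroOneLoss_nonneg _ _)
    (integrable_of_measurable_of_abs_le (measurable_rampLoss_comp hr hh)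
      fun _ => abs_rampLoss_le_one _ _)
    (ae_of_all _ fun _ => zeroOneLoss_le_rampLoss _ _)

theorem abs_rampRisk_sub_le (hr : Measurable r) {h h' : X × X → ℝ} (hh : Measurable h)
    (hh' : Measurable h') {β : ℝ} (hβ : ∀ z, |h z - h' z| ≤ β) :
    |rampRisk μ r h - rampRisk μ r h'| ≤ β := by
  unfold rampRisk
  rw [← integral_sub
    (integrable_of_measurable_of_abs_le (measurable_rampLoss_comp hr hh)
      fun _ => abs_rampLoss_le_one _ _)
    (integrable_of_measurable_of_abs_le (measurable_rampLoss_comp hr hh')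
      fun _ => abs_rampLoss_le_one _ _)]
  exact abs_integral_le_of_abs_le fun z => (abs_rampLoss_sub_le _ _ _).trans (hβ z)

variable {n m : ℕ}

/-- Expected generalization gap, for the ramp loss, of a learning algorithm on pairs that is stable
under changes of the training examples. -/
theorem integral_rampRisk_sub_le (hr : Measurable r) (hm : 1 ≤ m) (G : PairPattern n m)
    {A : (Fin m → Example (X × X)) → X × X → ℝ}
    (hA : Measurable fun p : (Fin m → Example (X × X)) × (X × X) => A p.1 p.2) {β : ℝ}
    (hβ : 0 ≤ β)
    (hstab : ∀ (D D' : Fin m → Example (X × X)) (S : Finset (Fin m)),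
      (∀ k ∉ S, D k = D' k) → ∀ z, |A D z - A D' z| ≤ S.card * β) :
    ∫ x, (rampRisk μ r (A (trainingSet r G x)) -
        empRampRisk (trainingSet r G x) (A (trainingSet r G x))) ∂(Measure.pi fun _ => μ)
      ≤ 2 * G.maxFreq * β := by
  have hm0 : (0 : ℝ) < m := by exact_mod_cast hm
  set P : Measure (Fin n → X) := Measure.pi fun _ => μ
  set Ψ : (Fin n → X) × (X × X) → ℝ := fun p => rampLoss (r p.2) (A (trainingSet r G p.1) p.2)
    with hΨ
  have hΨm : Measurable Ψ := measurable_rampLoss_comp (hr.comp measurable_snd)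
    (hA.comp (((measurable_trainingSet hr G).comp measurable_fst).prodMk measurable_snd))
  have hΨ1 : ∀ p, |Ψ p| ≤ 1 := fun p => abs_rampLoss_le_one _ _
  have hΨi : Integrable Ψ (P.prod (μ.prod μ)) := integrable_of_measurable_of_abs_le hΨm hΨ1
  have hzm : ∀ k, Measurable fun x : Fin n → X => (x, (x (G.pair k).1, x (G.pair k).2)) :=
    fun k => measurable_id.prodMk ((measurable_pi_apply _).prodMk (measurable_pi_apply _))
  have hki : ∀ k, Integrable (fun x => Ψ (x, (x (G.pair k).1, x (G.pair k).2))) P := fun k =>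
    integrable_of_measurable_of_abs_le (hΨm.comp (hzm k)) fun x => hΨ1 _
  have hrisk : ∫ x, rampRisk μ r (A (trainingSet r G x)) ∂P = ∫ p, Ψ p ∂(P.prod (μ.prod μ)) :=
    (integral_prod Ψ hΨi).symm
  have hrint : Integrable (fun x => rampRisk μ r (A (trainingSet r G x))) P :=
    hΨi.integral_prod_left
  have hemp : ∀ x, empRampRisk (trainingSet r G x) (A (trainingSet r G x)) =
      1 / (m : ℝ) * ∑ k, Ψ (x, (x (G.pair k).1, x (G.pair k).2)) := fun x => rfl
  -- After the exchange the test pair is the `k`-th original pair, while training uses the fresh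
  -- one; undoing the change in the training set costs at most `2 * G.maxFreq * β` by stability.
  have hpair : ∀ k, ∫ p, Ψ p ∂(P.prod (μ.prod μ)) ≤
      ∫ x, Ψ (x, (x (G.pair k).1, x (G.pair k).2)) ∂P + 2 * G.maxFreq * β := by
    intro k
    have hT := measurePreserving_update_pair μ (G.loopless k)
    have h1 : ∫ p, Ψ p ∂(P.prod (μ.prod μ)) = ∫ p, Ψ
        (Function.update (Function.update p.1 (G.pair k).1 p.2.1) (G.pair k).2 p.2.2,
          (p.1 (G.pair k).1, p.1 (G.pair k).2)) ∂(P.prod (μ.prod μ)) := by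
      conv_lhs => rw [← hT.map_eq]
      exact integral_map hT.measurable.aemeasurable hΨm.aestronglyMeasurable
    have h2 : ∫ x, Ψ (x, (x (G.pair k).1, x (G.pair k).2)) ∂P =
        ∫ p, Ψ (p.1, (p.1 (G.pair k).1, p.1 (G.pair k).2)) ∂(P.prod (μ.prod μ)) := by
      rw [integral_fun_fst (μ := P) (ν := μ.prod μ)
        (fun x => Ψ (x, (x (G.pair k).1, x (G.pair k).2)))]
      simp
    have h3 : Integrable (fun p : (Fin n → X) × (X × X) =>
        Ψ (p.1, (p.1 (G.pair k).1, p.1 (G.pair k).2))) (P.prod (μ.prod μ)) :=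
      integrable_of_measurable_of_abs_le (hΨm.comp ((hzm k).comp measurable_fst)) fun x => hΨ1 _
    rw [h1, h2]
    have h4 : ∫ p, (Ψ (p.1, (p.1 (G.pair k).1, p.1 (G.pair k).2)) + 2 * G.maxFreq * β)
        ∂(P.prod (μ.prod μ)) = ∫ p, Ψ (p.1, (p.1 (G.pair k).1, p.1 (G.pair k).2))
          ∂(P.prod (μ.prod μ)) + 2 * G.maxFreq * β := by
      rw [integral_add h3 (integrable_const _)]
      simp
    rw [← h4]
    refine integral_mono
      (integrable_of_measurable_of_abs_le (hΨm.comp hT.measurable) fun p => hΨ1 _)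
      (h3.add (integrable_const _)) fun p => ?_
    set S := G.incident (G.pair k).2 ∪ G.incident (G.pair k).1
    have hcard : (S.card : ℝ) ≤ 2 * G.maxFreq := by
      have : S.card ≤ G.maxFreq + G.maxFreq := (Finset.card_union_le _ _).trans
        (add_le_add (G.freq_le_maxFreq _) (G.freq_le_maxFreq _))
      rw [two_mul]
      exact_mod_cast this
    have hst := hstab (trainingSet r G (Function.update
      (Function.update p.1 (G.pair k).1 p.2.1) (G.pair k).2 p.2.2)) (trainingSet r G p.1) S
      (fun l hl => by
        rw [Finset.mem_union, not_or] at hl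
        rw [trainingSet_update_of_notMem _ _ _ _ _ hl.1,
          trainingSet_update_of_notMem _ _ _ _ _ hl.2]) (p.1 (G.pair k).1, p.1 (G.pair k).2)
    have := (abs_le.1 ((abs_rampLoss_sub_le (r (p.1 (G.pair k).1, p.1 (G.pair k).2)) _ _).trans
      (hst.trans (mul_le_mul_of_nonneg_right hcard hβ)))).2
    simp only [hΨ]
    linarith
  simp only [hemp]
  rw [integral_sub hrint ((integrable_finsetSum _ fun k _ => hki k).const_mul _), hrisk,
    integral_const_mul, integral_finsetSum _ fun k _ => hki k, sub_le_iff_le_add']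
  have := Finset.sum_le_sum fun k (_ : k ∈ Finset.univ) => hpair k
  rw [Finset.sum_add_distrib] at this
  simp only [Finset.sum_const, Finset.card_univ, Fintype.card_fin, nsmul_eq_mul] at this
  refine le_of_mul_le_mul_left (this.trans (le_of_eq ?_)) hm0
  field_simp

/-- High-probability generalization bound, for the ramp loss, of a learning algorithm on pairs that
is stable under changes of the training examples. -/
theorem measure_rampRisk_gt_le (hr : Measurable r) (hm : 1 ≤ m) (G : PairPattern n m)
    {A : (Fin m → Example (X × X)) → X × X → ℝ}
    (hA : Measurable fun p : (Fin m → Example (X × X)) × (X × X) => A p.1 p.2) {β : ℝ}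
    (hβ : 0 ≤ β)
    (hstab : ∀ (D D' : Fin m → Example (X × X)) (S : Finset (Fin m)),
      (∀ k ∉ S, D k = D' k) → ∀ z, |A D z - A D' z| ≤ S.card * β)
    {δ : ℝ} (hδ0 : 0 < δ) (hδ1 : δ < 1) :
    (Measure.pi fun _ : Fin n => μ) {x | empRampRisk (trainingSet r G x) (A (trainingSet r G x)) +
        2 * G.maxFreq * β + (2 * m * β + 1) * Real.sqrt (G.maxFreq / m * Real.log (1 / δ)) <
          rampRisk μ r (A (trainingSet r G x))} ≤ ENNReal.ofReal δ := by
  have hm0 : (0 : ℝ) < m := by exact_mod_cast hm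
  have hAD : ∀ D, Measurable (A D) := fun D => hA.comp (measurable_const.prodMk measurable_id)
  -- Makes the McDiarmid variance bound strictly positive.
  have hρ1 : 1 ≤ G.maxFreq := by
    refine le_trans ?_ (G.freq_le_maxFreq (G.pair ⟨0, hm⟩).1)
    exact Finset.card_pos.2 ⟨⟨0, hm⟩, by simp⟩
  have hρ : (0 : ℝ) < G.maxFreq := by exact_mod_cast hρ1
  set C : ℝ := 2 * m * β + 1
  have hC : 0 < C := by positivity
  have hL : 0 < Real.log (1 / δ) := Real.log_pos (by rw [one_div]; exact (one_lt_inv₀ hδ0).2 hδ1)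
  set f : (Fin n → X) → ℝ := fun x => rampRisk μ r (A (trainingSet r G x)) -
    empRampRisk (trainingSet r G x) (A (trainingSet r G x)) with hf
  have hTS := measurable_trainingSet (n := n) hr G
  have hfm : Measurable f := by
    refine Measurable.sub ?_ (measurable_const.mul (Finset.measurable_sum _ fun k _ => ?_))
    · have : Measurable fun p : (Fin n → X) × (X × X) =>
          rampLoss (r p.2) (A (trainingSet r G p.1) p.2) :=
        measurable_rampLoss_comp (hr.comp measurable_snd)
          (hA.comp ((hTS.comp measurable_fst).prodMk measurable_snd))
      exact this.stronglyMeasurable.integral_prod_right.measurable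
    · have hk : Measurable fun x : Fin n → X => trainingSet r G x k :=
        (measurable_pi_apply k).comp hTS
      exact measurable_rampLoss_comp (measurable_snd.comp hk)
        (hA.comp (hTS.prodMk (measurable_fst.comp hk)))
  have hfM : ∀ x, |f x| ≤ 1 + 1 := fun x => (abs_sub _ _).trans
    (add_le_add (abs_integral_le_of_abs_le fun _ => abs_rampLoss_le_one _ _)
      (abs_empRampRisk_le_one hm _ _))
  -- The true risk contributes `freq i * β`, the empirical risk `freq i * (β + 1 / m)`; together
  -- `freq i * C / m`.
  have hfc : ∀ i x y, |f (Function.update x i y) - f x| ≤ G.freq i * (C / m) := by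
    intro i x y
    have hS : ∀ k ∉ G.incident i,
        trainingSet r G (Function.update x i y) k = trainingSet r G x k :=
      fun k hk => trainingSet_update_of_notMem r G x i y hk
    have hβ' := hstab _ _ _ hS
    have h1 := abs_rampRisk_sub_le (μ := μ) hr (hAD _) (hAD _) hβ'
    have h2 := abs_empRampRisk_sub_le hm _ hS hβ'
    simp only [hf]
    rw [sub_sub_sub_comm]
    refine (abs_sub _ _).trans ((add_le_add h1 h2).trans (le_of_eq ?_))
    change (G.freq i : ℝ) * β + (G.freq i * β + G.freq i / m) = _
    simp only [C]
    field_simp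
    ring
  have hV : ∑ i, ((G.freq i : ℝ) * (C / m)) ^ 2 ≤ G.maxFreq * (2 * m) * (C / m) ^ 2 := by
    simp only [mul_pow]
    rw [← Finset.sum_mul]
    refine mul_le_mul_of_nonneg_right ?_ (sq_nonneg _)
    calc ∑ i, (G.freq i : ℝ) ^ 2 ≤ ∑ i, (G.maxFreq : ℝ) * G.freq i :=
          Finset.sum_le_sum fun i _ => by
            rw [sq]
            exact mul_le_mul_of_nonneg_right (by exact_mod_cast G.freq_le_maxFreq i)
              (Nat.cast_nonneg _)
      _ = G.maxFreq * ∑ i, (G.freq i : ℝ) := (Finset.mul_sum _ _ _).symm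
      _ ≤ _ := mul_le_mul_of_nonneg_left (by exact_mod_cast G.sum_freq_le) hρ.le
  -- With `V = 2ρ C² / m`, this `ε` is the one solving `2 ε² / V = log (1 / δ)`.
  have hmcd := measure_le_of_bounded_differences μ f hfm (1 + 1) hfM
    (fun i => (G.freq i : ℝ) * (C / m)) (fun i => by positivity) hfc
    (V := G.maxFreq * (2 * m) * (C / m) ^ 2) (by positivity) hV
    (ε := C * Real.sqrt (G.maxFreq / m * Real.log (1 / δ))) (by positivity)
  have hexp : Real.exp (-(2 * (C * Real.sqrt (G.maxFreq / m * Real.log (1 / δ))) ^ 2 /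
      (G.maxFreq * (2 * m) * (C / m) ^ 2))) = δ := by
    rw [mul_pow, Real.sq_sqrt (by positivity)]
    have : 2 * (C ^ 2 * (G.maxFreq / m * Real.log (1 / δ))) /
      (G.maxFreq * (2 * m) * (C / m) ^ 2) = Real.log (1 / δ) := by
      field_simp
    rw [this, one_div, Real.log_inv, neg_neg, Real.exp_log hδ0]
  rw [hexp] at hmcd
  refine (measure_mono fun x hx => ?_).trans hmcd
  have hE := integral_rampRisk_sub_le (μ := μ) hr hm G hA hβ hstab
  simp only [Set.mem_ofPred_eq] at hx ⊢
  simp only [hf]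
  linarith

end Gap

/-- A bound on the failure probability that holds for every fixed value of an independent discrete
variable holds for a random value. -/
theorem measure_prod_setOf_le {Ω I : Type*} [MeasurableSpace Ω] [MeasurableSpace I] [Finite I]
    [MeasurableSingletonClass I] (P : Measure Ω) [SFinite P] (ν : Measure I)
    [IsProbabilityMeasure ν] {p : Ω → I → Prop} {δ : ENNReal} (h : ∀ i, P {x | p x i} ≤ δ) :
    (P.prod ν) {q | p q.1 q.2} ≤ δ := by
  have := Fintype.ofFinite I
  -- Covering by rectangles avoids any measurability of the event; the slices carry weights `ν {i}`
  -- summing to `1`, so nothing is lost.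
  have hsub : {q : Ω × I | p q.1 q.2} ⊆ ⋃ i, {x | p x i} ×ˢ {i} := fun q hq =>
    Set.mem_iUnion.2 ⟨q.2, hq, rfl⟩
  calc (P.prod ν) {q | p q.1 q.2} ≤ ∑ i, (P.prod ν) ({x | p x i} ×ˢ {i}) :=
        (measure_mono hsub).trans (measure_iUnion_fintype_le _ _)
    _ = ∑ i, P {x | p x i} * ν {i} := by simp only [Measure.prod_prod]
    _ ≤ ∑ i, δ * ν {i} := Finset.sum_le_sum fun i _ => mul_le_mul_left (h i) _
    _ = δ := by
      rw [← Finset.mul_sum, sum_measure_singleton]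
      simp

end PairSVM
/-- The first part is for a fixed choice of pairs; the second is for a labeler that draws the pattern
at random (law `ν`) independently of the instances. "With probability at least `1 - δ`" is expressed
by: the (outer) probability that the bound fails is at most `δ`. -/
theorem mainTheorem4 {X : Type*} [MeasurableSpace X] (μ : Measure X) [IsProbabilityMeasure μ]
    (r : X × X → ℤˣ) (hr : Measurable r)
    {H : Type*} [NormedAddCommGroup H] [InnerProductSpace ℝ H] [CompleteSpace H]
    (Φ : X × X → H)
    (hK : Measurable (fun p : (X × X) × (X × X) => (inner ℝ (Φ p.1) (Φ p.2) : ℝ)))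
    (B : ℝ) (hB : ∀ z, ‖Φ z‖ ≤ B) (lam : ℝ) (hlam : 0 < lam)
    (n m : ℕ) (hn : 2 ≤ n) (hm : 1 ≤ m)
    (A : (Fin m → PairSVM.Example (X × X)) → (X × X → ℝ))
    (hA : PairSVM.IsSVMAlgorithm Φ lam A)
    (δ : ℝ) (hδ0 : 0 < δ) (hδ1 : δ < 1) :
    (∀ G : PairSVM.PairPattern n m,
      Measure.pi (fun _ : Fin n => μ)
        {x | ¬ PairSVM.zeroOneRisk μ r (A (PairSVM.trainingSet r G x))
              ≤ PairSVM.svmBound B lam δ G (PairSVM.trainingSet r G x)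
                  (A (PairSVM.trainingSet r G x))}
        ≤ ENNReal.ofReal δ) ∧
    (∀ ν : Measure (PairSVM.PairPattern n m), IsProbabilityMeasure ν →
      ((Measure.pi (fun _ : Fin n => μ)).prod ν)
        {q | ¬ PairSVM.zeroOneRisk μ r (A (PairSVM.trainingSet r q.2 q.1))
              ≤ PairSVM.svmBound B lam δ q.2 (PairSVM.trainingSet r q.2 q.1)
                  (A (PairSVM.trainingSet r q.2 q.1))}
        ≤ ENNReal.ofReal δ) := by
  have hm0 : (0 : ℝ) < m := by exact_mod_cast hm
  have hmeas := hA.measurable hK hB hlam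
  have fixed : ∀ G : PairSVM.PairPattern n m,
      Measure.pi (fun _ : Fin n => μ)
        {x | ¬ PairSVM.zeroOneRisk μ r (A (PairSVM.trainingSet r G x))
              ≤ PairSVM.svmBound B lam δ G (PairSVM.trainingSet r G x)
                  (A (PairSVM.trainingSet r G x))}
        ≤ ENNReal.ofReal δ := by
    intro G
    refine (measure_mono fun x hx => ?_).trans
      (PairSVM.measure_rampRisk_gt_le hr hm G hmeas (β := B ^ 2 / (lam * m)) (by positivity)
        (fun D D' S hS z => hA.abs_sub_le hm hB hlam S hS z) hδ0 hδ1)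
    rw [Set.mem_ofPred_eq, not_le] at hx
    have h1 := PairSVM.zeroOneRisk_le_rampRisk (μ := μ) hr
      (hmeas.comp ((measurable_const (a := PairSVM.trainingSet r G x)).prodMk measurable_id))
    have h2 := PairSVM.empRampRisk_le_empHingeRisk (PairSVM.trainingSet r G x)
      (A (PairSVM.trainingSet r G x))
    have h3 : 2 * (G.maxFreq : ℝ) * (B ^ 2 / (lam * m)) =
        2 * (G.maxFreq : ℝ) * B ^ 2 / (lam * m) := by ring
    -- The factor `2mβ + 1` becomes the stated `2B² / lam + 1`.
    have h4 : 2 * (m : ℝ) * (B ^ 2 / (lam * m)) = 2 * B ^ 2 / lam := by field_simp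
    rw [Set.mem_ofPred_eq, h3, h4]
    unfold PairSVM.svmBound at hx
    exact lt_of_le_of_lt (by gcongr) (hx.trans_le h1)
  exact ⟨fixed, fun ν _ => PairSVM.measure_prod_setOf_le _ ν fixed⟩
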